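/- For a real number $D\ge 1$, a compact Hausdorff topological group $G$ is called $D$-quasirandom if every continuous unitary representation $\rho:G\to U(n)$ with $n<D$ is trivial, i.e. $\rho(g)=1$ for all $g\in G$. Let $\mu$ be the normalized Haar measure on $G$. For $f\in L^2(G,\mu)$ (complex-valued) and $g\in G$ put $(g\cdot_l f)(x)=f(g^{-1}x)$ and $(g\cdot_c f)(x)=f(g^{-1}xg)$, and let $P_l$ and $P_c$ be the orthogonal projections of $L^2(G,\mu)$ onto the closed subspaces of those $f$ with $g\cdot_l f=f$ for all $g\in G$, respectively $g\cdot_c f=f$ for all $g\in G$. **Corollary.** Let $D\ge 1$ and let $(G,\mu)$ be a $D$-quasirandom compact Hausdorff group with its normalized Haar measure. Then for any $f_1,f_2,f_3\in L^2(G,\mu)$ with $\|f_1\|_{L^\infty},\|f_2\|_{L^\infty},\|f_3\|_{L^\infty}\le 1$, the function of $g$ integrated below is $\mu$-integrable and $$\int_G\left|\int_G f_1(x)\,(g\cdot_l f_2)(x)\,(g\cdot_c f_3)(x)\,d\mu(x)-\int_G f_1(x)\,P_l(f_2)(x)\,P_c(f_3)(x)\,d\mu(x)\right|d\mu(g)\;\le\;4D^{-1/4}.$$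 -/

import Mathlib

open MeasureTheory
open scoped ENNReal

noncomputable section

/-- A topological group `G` is `D`-quasirandom if it has no nontrivial (continuous,
finite-dimensional, complex) unitary representation of dimension less than `D`. -/
def IsQuasirandom (G : Type*) [Group G] [TopologicalSpace G] (D : ℝ) : Prop :=
  ∀ (n : ℕ) (ρ : G →* Matrix.unitaryGroup (Fin n) ℂ),
    Continuous ρ → (n : ℝ) < D → ∀ g : G, ρ g = 1

section Koopman

variable {G X : Type*} [Group G] [MeasurableSpace X] {ν : Measure X}

/-- The Koopman representation on `L²(X, ν)` of an action `a` of `G` on `X` by measure-preserving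
transformations: `(g · f)(x) = f (g⁻¹ · x)`. -/
def koopman (a : G →* Equiv.Perm X) (ha : ∀ g, MeasurePreserving (a g) ν ν) (g : G) :
    Lp ℂ 2 ν →ₗᵢ[ℂ] Lp ℂ 2 ν :=
  Lp.compMeasurePreservingₗᵢ ℂ (a g⁻¹) (ha g⁻¹)

/-- The closed subspace of all `f` in `L²(X, ν)` with `g · f = f` for every `g`. -/
def invariantSubspace (a : G →* Equiv.Perm X) (ha : ∀ g, MeasurePreserving (a g) ν ν) :
    Submodule ℂ (Lp ℂ 2 ν) :=
  ⨅ g : G, LinearMap.eqLocus (koopman a ha g).toLinearMap LinearMap.id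

theorem mem_invariantSubspace (a : G →* Equiv.Perm X)
    (ha : ∀ g, MeasurePreserving (a g) ν ν) (f : Lp ℂ 2 ν) :
    f ∈ invariantSubspace a ha ↔ ∀ g : G, koopman a ha g f = f := by
  simp [invariantSubspace, Submodule.mem_iInf]

theorem isClosed_invariantSubspace (a : G →* Equiv.Perm X)
    (ha : ∀ g, MeasurePreserving (a g) ν ν) :
    IsClosed (invariantSubspace a ha : Set (Lp ℂ 2 ν)) := by
  have h : (invariantSubspace a ha : Set (Lp ℂ 2 ν)) = ⋂ g : G, {f | koopman a ha g f = f} := by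
    ext f
    simp [mem_invariantSubspace]
  rw [h]
  exact isClosed_iInter fun g => isClosed_eq (koopman a ha g).continuous continuous_id

instance (a : G →* Equiv.Perm X) (ha : ∀ g, MeasurePreserving (a g) ν ν) :
    CompleteSpace (invariantSubspace a ha) :=
  (isClosed_invariantSubspace a ha).completeSpace_coe

/-- The orthogonal projection of `L²(X, ν)` onto the subspace of invariant functions. -/
def invariantProj (a : G →* Equiv.Perm X) (ha : ∀ g, MeasurePreserving (a g) ν ν) :
    Lp ℂ 2 ν →L[ℂ] Lp ℂ 2 ν :=
  (invariantSubspace a ha).starProjection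

end Koopman

/-- The left translation action of a group on itself, `g · x = g * x`. -/
def leftTranslation (G : Type*) [Group G] : G →* Equiv.Perm G :=
  MulAction.toPermHom G G

/-- The conjugation action of a group on itself, `g · x = g * x * g⁻¹`. -/
def conjugation (G : Type*) [Group G] : G →* Equiv.Perm G :=
  (MulAut.toPerm G).comp MulAut.conj

section Haar

variable {G : Type*} [Group G] [TopologicalSpace G] [IsTopologicalGroup G]
  [MeasurableSpace G] [BorelSpace G]

theorem leftTranslation_measurePreserving (μ : Measure G) [μ.IsHaarMeasure] (g : G) :
    MeasurePreserving (leftTranslation G g) μ μ :=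
  measurePreserving_mul_left μ g

theorem conjugation_measurePreserving [CompactSpace G] (μ : Measure G) [μ.IsHaarMeasure]
    [IsProbabilityMeasure μ] (g : G) : MeasurePreserving (conjugation G g) μ μ := by
  have hr : MeasurePreserving (fun x : G => x * g⁻¹) μ μ := by
    refine ⟨measurable_mul_const _, ?_⟩
    have : IsProbabilityMeasure (μ.map (fun x : G => x * g⁻¹)) :=
      Measure.isProbabilityMeasure_map (measurable_mul_const _).aemeasurable
    exact Measure.isHaarMeasure_eq_of_isProbabilityMeasure _ μ
  exact hr.comp (measurePreserving_mul_left μ g)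

variable [CompactSpace G] (μ : Measure G) [μ.IsHaarMeasure] [IsProbabilityMeasure μ]

/-- The left translate `g ·ₗ f`, that is, `(g ·ₗ f)(x) = f (g⁻¹ x)`. -/
def leftKoopman (g : G) (f : Lp ℂ 2 μ) : Lp ℂ 2 μ :=
  koopman (leftTranslation G) (leftTranslation_measurePreserving μ) g f

/-- The conjugate `g ·_c f`, that is, `(g ·_c f)(x) = f (g⁻¹ x g)`. -/
def conjKoopman (g : G) (f : Lp ℂ 2 μ) : Lp ℂ 2 μ :=
  koopman (conjugation G) (conjugation_measurePreserving μ) g f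

/-- The orthogonal projection `P_l` onto the functions invariant under left translations. -/
def leftProj (f : Lp ℂ 2 μ) : Lp ℂ 2 μ :=
  invariantProj (leftTranslation G) (leftTranslation_measurePreserving μ) f

/-- The orthogonal projection `P_c` onto the functions invariant under conjugations. -/
def conjProj (f : Lp ℂ 2 μ) : Lp ℂ 2 μ :=
  invariantProj (conjugation G) (conjugation_measurePreserving μ) f

/-- The triple-recurrence error
`|∫ f₁ (g ·ₗ f₂) (g ·_c f₃) dμ - ∫ f₁ P_l(f₂) P_c(f₃) dμ|` at the group element `g`. -/
def recurrenceError (f₁ f₂ f₃ : Lp ℂ 2 μ) (g : G) : ℝ :=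
  ‖(∫ x, f₁ x * leftKoopman μ g f₂ x * conjKoopman μ g f₃ x ∂μ)
    - ∫ x, f₁ x * leftProj μ f₂ x * conjProj μ f₃ x ∂μ‖

end Haar

end

/-!
Three ideas carry the proof.

*Matrix coefficients are small.* Let `π` be a strongly continuous unitary representation of a
`D`-quasirandom compact group and let `v` be orthogonal to the fixed vectors. The operator
`A = ∫ ⟪π g v, ·⟫ • π g v` is compact, self-adjoint and positive, commutes with `π`, and has trace
`‖v‖ ^ 2`. An eigenspace of `A` for an eigenvalue `z ≠ 0` is finite-dimensional and invariant; it
cannot consist of fixed vectors, since `A` kills those, so quasirandomness makes its dimension at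
least `D`, and the trace gives `D * ‖z‖ ≤ ‖v‖ ^ 2`. Hence `‖A‖ ≤ ‖v‖ ^ 2 / D`, which is the bound
`∫ ‖⟪u, π g v⟫‖ ^ 2 ≤ ‖u‖ ^ 2 * ‖v‖ ^ 2 / D`. For arbitrary `v` it bounds the variance of
`g ↦ ⟪u, π g v⟫` (`IsQuasirandom.variance_inner_le`). No Peter–Weyl theorem or Schur orthogonality
is needed.

*Van der Corput.* Let `f₁, f₂, f₃` be continuous and bounded by `1`. Replacing `f₂` by its mean
leaves a matrix coefficient of the conjugation representation, with error `D ^ (-1/2)` in mean. For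
`q = f₂ - ∫ f₂` the correlation is `F g = ⟪conj f₁, v g⟫` with
`v g x = q (g⁻¹ x) * f₃ (g⁻¹ x g)`. The mean square of `F` is at most the Hilbert–Schmidt norm of
the kernel `⟪v g', v g⟫` (`sq_integral_norm_sq_le_gram`), and after a translation of the variable
`⟪v (g h), v g⟫` is, for fixed `h`, a matrix coefficient of the right regular representation at `g`.
Its mean over `g` contains the factor `∫ q x * conj (q (h⁻¹ x))`, a matrix coefficient in `h` of the
left regular representation whose own mean vanishes because `∫ q = 0`. Two uses of the variance
bound give a mean square of order `D ^ (-1/2)`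
(`IsQuasirandom.sq_integral_triple_correlation_le`).

*Approximation.* The recurrence error is Lipschitz for the `L²` norm on functions bounded by `1`
(`abs_recurrenceError_sub_le`), and such functions are `L²`-limits of continuous functions bounded
by `1`. For continuous functions all the integrands are continuous on compact products, where the
order of integration may be exchanged although the Borel σ-algebra of `G × G` need not be the
product σ-algebra.
-/

open scoped InnerProductSpace ComplexConjugate Topology

/-! ### Matrix coefficients of representations of quasirandom groups -/

theorem Continuous.integrable_of_compactSpace {X E : Type*} [TopologicalSpace X] [CompactSpace X]
    [MeasurableSpace X] [OpensMeasurableSpace X] [NormedAddCommGroup E]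
    {μ : Measure X} [IsFiniteMeasure μ] {f : X → E} (hf : Continuous f) : Integrable f μ :=
  hf.integrable_of_hasCompactSupport (HasCompactSupport.of_compactSpace f)

section UnitaryRepresentation

variable {G H : Type*} [Group G] [TopologicalSpace G]
  [NormedAddCommGroup H] [InnerProductSpace ℂ H]

omit [TopologicalSpace G] in
theorem representation_mul_apply (π : G →* (H →ₗᵢ[ℂ] H)) (g h : G) (v : H) :
    π (g * h) v = π g (π h v) := by
  rw [map_mul]; rfl

omit [TopologicalSpace G] in
theorem inner_representation_inv (π : G →* (H →ₗᵢ[ℂ] H)) (g : G) (u v : H) :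
    ⟪π g u, v⟫_ℂ = ⟪u, π g⁻¹ v⟫_ℂ := by
  rw [← (π g⁻¹).inner_map_map, ← representation_mul_apply]
  simp

theorem sum_inner_smul_of_mem {n : ℕ} {E : Submodule ℂ H} (b : OrthonormalBasis (Fin n) ℂ E) {w : H}
    (hw : w ∈ E) : ∑ j, ⟪(b j : H), w⟫_ℂ • (b j : H) = w := by
  have := congrArg (Subtype.val) (b.sum_repr' ⟨w, hw⟩)
  simpa using this

/-- A finite-dimensional invariant subspace, of dimension less than `D`, of a strongly continuous
unitary representation of a `D`-quasirandom group consists of fixed vectors: in an orthonormal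
basis the restricted representation is a continuous homomorphism to a unitary group. -/
theorem IsQuasirandom.fixed_of_finrank_lt {D : ℝ} (hG : IsQuasirandom G D)
    (π : G →* (H →ₗᵢ[ℂ] H)) (hπ : ∀ v, Continuous fun g => π g v)
    (E : Submodule ℂ H) [FiniteDimensional ℂ E] (hE : ∀ g, ∀ w ∈ E, π g w ∈ E)
    (hD : (Module.finrank ℂ E : ℝ) < D) (g : G) {w : H} (hw : w ∈ E) : π g w = w := by
  set b := stdOrthonormalBasis ℂ E
  let M : G → Matrix (Fin (Module.finrank ℂ E)) (Fin (Module.finrank ℂ E)) ℂ :=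
    fun g => Matrix.of fun i j => ⟪(b i : H), π g (b j)⟫_ℂ
  have hmul : ∀ g h, M (g * h) = M g * M h := by
    intro g h
    ext i k
    simp only [M, Matrix.of_apply, Matrix.mul_apply]
    rw [representation_mul_apply]
    conv_lhs => rw [← sum_inner_smul_of_mem b (hE h _ (b k).2)]
    simp [mul_comm]
  have hone : M 1 = 1 := by
    ext i j
    have := orthonormal_iff_ite.mp b.orthonormal i j
    simpa [M, Matrix.one_apply] using this
  have hstar : ∀ g, star (M g) = M g⁻¹ := by
    intro g
    ext i j
    simp only [M, Matrix.of_apply, Matrix.star_apply, RCLike.star_def, inner_conj_symm]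
    exact inner_representation_inv π g _ _
  let ρ : G →* Matrix.unitaryGroup (Fin (Module.finrank ℂ E)) ℂ :=
    { toFun := fun g => ⟨M g, by
        rw [Matrix.mem_unitaryGroup_iff, hstar, ← hmul, mul_inv_cancel, hone]⟩
      map_one' := Subtype.ext hone
      map_mul' := fun g h => Subtype.ext (hmul g h) }
  have hρ : Continuous ρ := by
    refine Continuous.subtype_mk (continuous_matrix fun i j => ?_) _
    exact (continuous_const).inner (hπ _)
  have htriv : M g = 1 := congrArg Subtype.val (hG _ ρ hρ hD g)
  have hb : ∀ j, π g (b j) = b j := by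
    intro j
    rw [← sum_inner_smul_of_mem b (hE g _ (b j).2)]
    have : ∀ i, ⟪(b i : H), π g (b j)⟫_ℂ = if i = j then 1 else 0 := fun i => by
      have := congrFun (congrFun htriv i) j
      simpa [M, Matrix.one_apply] using this
    simp [this]
  rw [← sum_inner_smul_of_mem b hw]
  simp [hb]

variable [CompactSpace G] [MeasurableSpace G] [BorelSpace G] [CompleteSpace H]
  (μ : Measure G) [IsProbabilityMeasure μ]

/-- The average over `g` of the rank-one operators `w ↦ ⟪π g v, w⟫ • π g v`; its quadratic form at
`u` is the mean square of the matrix coefficient `g ↦ ⟪u, π g v⟫`. -/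
noncomputable def coefficientOperator (π : G →* (H →ₗᵢ[ℂ] H)) (v : H) : H →L[ℂ] H :=
  ∫ g, InnerProductSpace.rankOne ℂ (π g v) (π g v) ∂μ

variable {μ} {π : G →* (H →ₗᵢ[ℂ] H)} (hπ : ∀ v, Continuous fun g => π g v)

include hπ

omit [CompactSpace G] [MeasurableSpace G] [BorelSpace G] in
theorem continuous_rankOne_orbit (v : H) :
    Continuous fun g => InnerProductSpace.rankOne ℂ (π g v) (π g v) := by
  exact (ContinuousLinearMap.smulRightL ℂ H H).continuous₂.comp
    (((innerSL ℂ).continuous.comp (hπ v)).prodMk (hπ v))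

theorem coefficientOperator_apply (v w : H) :
    coefficientOperator μ π v w = ∫ g, ⟪π g v, w⟫_ℂ • π g v ∂μ := by
  rw [coefficientOperator,
    ContinuousLinearMap.integral_apply (continuous_rankOne_orbit hπ v).integrable_of_compactSpace]
  rfl

theorem inner_coefficientOperator (v u w : H) :
    ⟪u, coefficientOperator μ π v w⟫_ℂ = ∫ g, ⟪π g v, w⟫_ℂ * ⟪u, π g v⟫_ℂ ∂μ := by
  have := hπ v
  rw [coefficientOperator_apply hπ, ← integral_inner]
  · simp [inner_smul_right]
  · exact Continuous.integrable_of_compactSpace (by fun_prop)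

theorem inner_coefficientOperator_self (v u : H) :
    ⟪u, coefficientOperator μ π v u⟫_ℂ = ((∫ g, ‖⟪u, π g v⟫_ℂ‖ ^ 2 ∂μ : ℝ) : ℂ) := by
  rw [inner_coefficientOperator hπ, ← integral_complex_ofReal]
  congr 1 with g
  rw [← inner_conj_symm, ← Complex.normSq_eq_conj_mul_self, Complex.normSq_eq_norm_sq]

theorem coefficientOperator_isSymmetric (v : H) : (coefficientOperator μ π v).IsSymmetric := by
  intro u w
  simp only [ContinuousLinearMap.coe_coe]
  rw [← inner_conj_symm, inner_coefficientOperator hπ, inner_coefficientOperator hπ,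
    ← integral_conj]
  congr 1 with g
  simp [mul_comm]

/-- The operator is an average of rank-one operators, and the compact operators form a closed
convex set. -/
theorem isCompactOperator_coefficientOperator (v : H) :
    IsCompactOperator (coefficientOperator μ π v) := by
  have hconv : Convex ℝ ((compactOperator (RingHom.id ℂ) H H : Submodule ℂ (H →L[ℂ] H)) :
      Set (H →L[ℂ] H)) := Submodule.convex ((compactOperator (RingHom.id ℂ) H H).restrictScalars ℝ)
  refine hconv.integral_mem isClosed_setOfPred_isCompactOperator (.of_forall fun g => ?_)
    (continuous_rankOne_orbit hπ v).integrable_of_compactSpace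
  rw [InnerProductSpace.rankOne_def']
  exact ((isCompactOperator_id (E := ℂ)).clm_comp
    (ContinuousLinearMap.toSpanSingleton ℂ (π g v))).comp_clm (innerSL ℂ (π g v))

variable [IsTopologicalGroup G] [μ.IsMulLeftInvariant]

theorem coefficientOperator_comm (v w : H) (h : G) :
    π h (coefficientOperator μ π v w) = coefficientOperator μ π v (π h w) := by
  have := hπ v
  have hc : (π h) (coefficientOperator μ π v w)
      = (π h).toContinuousLinearMap (coefficientOperator μ π v w) := rfl
  rw [hc, coefficientOperator_apply hπ, coefficientOperator_apply hπ,
    ← ContinuousLinearMap.integral_comp_comm _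
      (Continuous.integrable_of_compactSpace (by fun_prop)),
    ← integral_mul_left_eq_self (μ := μ) (fun g => ⟪π g v, π h w⟫_ℂ • π g v) h]
  congr 1 with g
  simp

/-- A nonzero eigenvalue of the coefficient operator has
an eigenspace which is an invariant subspace without nonzero fixed vectors, so of dimension at least
`D`, while the operator has trace `‖v‖ ^ 2`. -/
theorem IsQuasirandom.norm_coefficientOperator_le {D : ℝ} (hD : 0 < D) (hG : IsQuasirandom G D)
    {v : H} (hv : ∀ w, (∀ g, π g w = w) → ⟪w, v⟫_ℂ = 0) :
    ‖coefficientOperator μ π v‖ ≤ ‖v‖ ^ 2 / D := by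
  set A := coefficientOperator μ π v
  have hA : IsCompactOperator A := isCompactOperator_coefficientOperator hπ v
  have hS : A.IsSymmetric := coefficientOperator_isSymmetric hπ v
  have key : ∀ z ∈ spectrum ℂ A, ‖z‖ ≤ ‖v‖ ^ 2 / D := by
    intro z hz
    by_cases hz0 : z = 0
    · simp only [hz0, norm_zero]; positivity
    have hev := (hA.hasEigenvalue_iff_mem_spectrum hz0).mpr hz
    have hfin := ContinuousLinearMap.finite_dimensional_eigenspace hA z hz0
    set E := Module.End.eigenspace A.toLinearMap z
    have hmem : ∀ w, w ∈ E ↔ A w = z • w := fun w => Module.End.mem_eigenspace_iff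
    have hinv : ∀ g, ∀ w ∈ E, π g w ∈ E := by
      intro g w hw
      rw [hmem] at hw ⊢
      rw [← coefficientOperator_comm hπ, hw, map_smul]
    -- by quasirandomness a smaller eigenspace would consist of fixed vectors, which `A` kills
    have hdim : D ≤ Module.finrank ℂ E := by
      by_contra hlt
      push Not at hlt
      obtain ⟨w, hw, hw0⟩ := hev.exists_hasEigenvector
      have hfix : ∀ g, π g w = w := fun g =>
        hG.fixed_of_finrank_lt π hπ E hinv hlt g hw
      have hzero : A w = 0 := by
        have hin : ∀ g, ⟪π g v, w⟫_ℂ = 0 := by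
          intro g
          rw [inner_representation_inv, hfix, ← inner_conj_symm, hv w hfix, map_zero]
        rw [coefficientOperator_apply hπ]
        simp [hin]
      rw [(hmem w).mp hw] at hzero
      exact (smul_ne_zero hz0 hw0) hzero
    set b := stdOrthonormalBasis ℂ E
    have hb : Orthonormal ℂ (fun i => (b i : H)) := by
      exact b.orthonormal.comp_linearIsometry E.subtypeₗᵢ
    have hquad : ∀ i, ((∫ g, ‖⟪(b i : H), π g v⟫_ℂ‖ ^ 2 ∂μ : ℝ) : ℂ) = z := by
      intro i
      rw [← inner_coefficientOperator_self hπ, (hmem _).mp (b i).2, inner_smul_right,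
        inner_self_eq_norm_sq_to_K, hb.1 i]
      simp
    have hnorm : ∀ i, ‖z‖ = ∫ g, ‖⟪(b i : H), π g v⟫_ℂ‖ ^ 2 ∂μ := by
      intro i
      rw [← hquad i, Complex.norm_real, Real.norm_of_nonneg]
      exact integral_nonneg fun g => by positivity
    have hcv := hπ v
    have htrace : (Module.finrank ℂ E : ℝ) * ‖z‖ ≤ ‖v‖ ^ 2 := by
      calc (Module.finrank ℂ E : ℝ) * ‖z‖ = ∑ i, ∫ g, ‖⟪(b i : H), π g v⟫_ℂ‖ ^ 2 ∂μ := by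
            rw [← Finset.sum_congr rfl fun i _ => hnorm i]; simp
        _ = ∫ g, ∑ i, ‖⟪(b i : H), π g v⟫_ℂ‖ ^ 2 ∂μ := by
            rw [integral_finsetSum]
            exact fun i _ => Continuous.integrable_of_compactSpace (by fun_prop)
        _ ≤ ∫ g, ‖v‖ ^ 2 ∂μ := by
            refine integral_mono (Continuous.integrable_of_compactSpace (by fun_prop))
              (integrable_const _) fun g => ?_
            have := hb.sum_inner_products_le (s := Finset.univ) (π g v)
            rwa [(π g).norm_map] at this
        _ = ‖v‖ ^ 2 := by simp
    rw [le_div_iff₀ hD]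
    nlinarith [norm_nonneg z]
  have hc : 0 ≤ ‖v‖ ^ 2 / D := by positivity
  have hr : spectralRadius ℂ A ≤ ENNReal.ofReal (‖v‖ ^ 2 / D) := by
    refine iSup₂_le fun z hz => ?_
    rw [← enorm_eq_nnnorm, ← ofReal_norm]
    exact ENNReal.ofReal_le_ofReal (key z hz)
  rw [A.spectralRadius_eq_nnnorm hS.isSelfAdjoint, ← enorm_eq_nnnorm, ← ofReal_norm,
    ENNReal.ofReal_le_ofReal_iff hc] at hr
  exact hr

/-- Mean square bound for the matrix coefficients of a vector orthogonal to the fixed vectors. -/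
theorem IsQuasirandom.integral_norm_inner_sq_le {D : ℝ} (hD : 0 < D) (hG : IsQuasirandom G D)
    (u : H) {v : H} (hv : ∀ w, (∀ g, π g w = w) → ⟪w, v⟫_ℂ = 0) :
    ∫ g, ‖⟪u, π g v⟫_ℂ‖ ^ 2 ∂μ ≤ ‖u‖ ^ 2 * ‖v‖ ^ 2 / D := by
  have h1 := inner_coefficientOperator_self (μ := μ) hπ v u
  have h2 : ‖⟪u, coefficientOperator μ π v u⟫_ℂ‖ ≤ ‖u‖ * (‖v‖ ^ 2 / D * ‖u‖) :=
    (norm_inner_le_norm _ _).trans (mul_le_mul_of_nonneg_left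
      (ContinuousLinearMap.le_of_opNorm_le _ (hG.norm_coefficientOperator_le hπ hD hv) u)
      (norm_nonneg _))
  rw [h1, Complex.norm_real] at h2
  calc _ ≤ _ := (le_abs_self _).trans h2
    _ = _ := by ring

theorem representation_integral_orbit (v : H) (h : G) : π h (∫ g, π g v ∂μ) = ∫ g, π g v ∂μ := by
  have hc : (π h) (∫ g, π g v ∂μ) = (π h).toContinuousLinearMap (∫ g, π g v ∂μ) := rfl
  rw [hc, ← ContinuousLinearMap.integral_comp_comm _ (hπ v).integrable_of_compactSpace,
    ← integral_mul_left_eq_self (μ := μ) (fun g => π g v) h]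
  simp

omit [IsTopologicalGroup G] [μ.IsMulLeftInvariant] in
theorem inner_integral_orbit_of_fixed (v : H) {w : H} (hw : ∀ g, π g w = w) :
    ⟪w, ∫ g, π g v ∂μ⟫_ℂ = ⟪w, v⟫_ℂ := by
  rw [← integral_inner (hπ v).integrable_of_compactSpace]
  have : ∀ g, ⟪w, π g v⟫_ℂ = ⟪w, v⟫_ℂ := fun g => by
    conv_lhs => rw [← hw g, (π g).inner_map_map]
  simp [this]

/-- The matrix coefficient `g ↦ ⟪u, π g v⟫` has variance at most `‖u‖ ^ 2 * ‖v‖ ^ 2 / D`. -/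
theorem IsQuasirandom.variance_inner_le {D : ℝ} (hD : 0 < D) (hG : IsQuasirandom G D) (u v : H) :
    ∫ g, ‖⟪u, π g v⟫_ℂ - ∫ h, ⟪u, π h v⟫_ℂ ∂μ‖ ^ 2 ∂μ ≤ ‖u‖ ^ 2 * ‖v‖ ^ 2 / D := by
  -- the average `p` is fixed, and `v - p` is orthogonal to the fixed vectors
  set p := ∫ g, π g v ∂μ
  have hpfix : ∀ g, π g p = p := representation_integral_orbit hπ v
  have horth : ∀ w, (∀ g, π g w = w) → ⟪w, v - p⟫_ℂ = 0 := fun w hw => by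
    rw [inner_sub_right, inner_integral_orbit_of_fixed hπ v hw, sub_self]
  have hle : ‖v - p‖ ^ 2 ≤ ‖v‖ ^ 2 := by
    have hpy := norm_add_sq_eq_norm_sq_add_norm_sq_of_inner_eq_zero p (v - p) (horth p hpfix)
    rw [add_sub_cancel] at hpy
    nlinarith [norm_nonneg p]
  have hrw : ∀ g, ⟪u, π g v⟫_ℂ - ∫ h, ⟪u, π h v⟫_ℂ ∂μ = ⟪u, π g (v - p)⟫_ℂ := fun g => by
    rw [integral_inner (hπ v).integrable_of_compactSpace, map_sub, hpfix, inner_sub_right]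
  simp_rw [hrw]
  refine (hG.integral_norm_inner_sq_le hπ hD u horth).trans ?_
  gcongr

end UnitaryRepresentation

/-! ### Integrals of continuous functions on compact spaces -/

section ContinuousIntegrals

/-- No countability is assumed of `X` or `Y`: the parameter space is mapped continuously into
`C(Y, E)`, on which integration is Lipschitz. -/
theorem continuous_integral_of_compactSpace {X Y E : Type*} [TopologicalSpace X]
    [TopologicalSpace Y] [CompactSpace Y] [MeasurableSpace Y] [OpensMeasurableSpace Y]
    [NormedAddCommGroup E] [NormedSpace ℝ E] {μ : Measure Y} [IsProbabilityMeasure μ]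
    {f : X → Y → E} (hf : Continuous f.uncurry) : Continuous fun x => ∫ y, f x y ∂μ := by
  let F : C(X, C(Y, E)) := ContinuousMap.curry ⟨f.uncurry, hf⟩
  have hI : LipschitzWith 1 fun k : C(Y, E) => ∫ y, k y ∂μ := by
    refine LipschitzWith.of_dist_le_mul fun k l => ?_
    rw [dist_eq_norm, ← integral_sub k.continuous.integrable_of_compactSpace
      l.continuous.integrable_of_compactSpace]
    have h := norm_integral_le_of_norm_le_const (μ := μ) (f := fun y => k y - l y) (C := dist k l)
      (.of_forall fun y => (dist_eq_norm (k y) (l y)).symm.le.trans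
        (ContinuousMap.dist_apply_le_dist y))
    simpa using h
  exact hI.continuous.comp F.continuous

theorem integral_swap_of_compactSpace {X Y E : Type*} [TopologicalSpace X] [CompactSpace X]
    [MeasurableSpace X] [OpensMeasurableSpace X] [TopologicalSpace Y] [CompactSpace Y]
    [MeasurableSpace Y] [OpensMeasurableSpace Y] [NormedAddCommGroup E] [NormedSpace ℝ E]
    {μ : Measure X} [IsFiniteMeasure μ] {ν : Measure Y} [IsFiniteMeasure ν]
    {f : X → Y → E} (hf : Continuous f.uncurry) :
    ∫ x, ∫ y, f x y ∂ν ∂μ = ∫ y, ∫ x, f x y ∂μ ∂ν :=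
  integral_integral_swap_of_hasCompactSupport hf (HasCompactSupport.of_compactSpace _)

theorem sq_integral_le_integral_sq {X : Type*} [MeasurableSpace X] {μ : Measure X}
    [IsProbabilityMeasure μ] {w : X → ℝ} (hw : Integrable w μ)
    (hw2 : Integrable (fun x => w x ^ 2) μ) : (∫ x, w x ∂μ) ^ 2 ≤ ∫ x, w x ^ 2 ∂μ := by
  set m := ∫ x, w x ∂μ
  have h : 0 ≤ ∫ x, (w x - m) ^ 2 ∂μ := integral_nonneg fun x => sq_nonneg _
  have e : ∫ x, (w x - m) ^ 2 ∂μ = ∫ x, (w x ^ 2 - 2 * m * w x + m ^ 2) ∂μ := by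
    congr 1 with x; ring
  have hw' : Integrable (fun x => 2 * m * w x) μ := hw.const_mul _
  have hd : Integrable (fun x => w x ^ 2 - 2 * m * w x) μ := hw2.sub hw'
  rw [e, integral_add hd (integrable_const _), integral_sub hw2 hw', integral_const_mul] at h
  simp only [integral_const, probReal_univ, one_smul] at h
  change 0 ≤ (∫ x, w x ^ 2 ∂μ) - 2 * m * m + m ^ 2 at h
  nlinarith

/-- If `F g = ∫ p x * v g x` with `‖p‖ ≤ 1`, the mean square of `F` is controlled by the
Hilbert–Schmidt norm of the Gram kernel `∫ v g x * conj (v g' x)`. -/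
theorem sq_integral_norm_sq_le_gram {G X : Type*} [TopologicalSpace G] [CompactSpace G]
    [MeasurableSpace G] [BorelSpace G] [TopologicalSpace X] [CompactSpace X]
    [MeasurableSpace X] [BorelSpace X] {ν : Measure G} [IsProbabilityMeasure ν]
    {μ : Measure X} [IsProbabilityMeasure μ]
    {p : X → ℂ} (hp : Continuous p) (hp1 : ∀ x, ‖p x‖ ≤ 1)
    {v : G → X → ℂ} (hv : Continuous v.uncurry) :
    (∫ g, ‖∫ x, p x * v g x ∂μ‖ ^ 2 ∂ν) ^ 2
      ≤ ∫ g, ∫ g', ‖∫ x, v g x * conj (v g' x) ∂μ‖ ^ 2 ∂ν ∂ν := by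
  have hv' : Continuous fun z : G × X => v z.1 z.2 := hv
  set F : G → ℂ := fun g => ∫ x, p x * v g x ∂μ with hF
  set K : G → G → ℂ := fun g g' => ∫ x, v g x * conj (v g' x) ∂μ with hK
  have hFc : Continuous F := continuous_integral_of_compactSpace (by
    change Continuous fun z : G × X => p z.2 * v z.1 z.2; fun_prop)
  have hKc : Continuous fun z : G × G => K z.1 z.2 := continuous_integral_of_compactSpace (by
    change Continuous fun z : (G × G) × X => v z.1.1 z.2 * conj (v z.1.2 z.2)
    have h1 : Continuous fun z : (G × G) × X => v z.1.1 z.2 :=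
      hv'.comp (f := fun z : (G × G) × X => (z.1.1, z.2)) (by fun_prop)
    have h2 : Continuous fun z : (G × G) × X => v z.1.2 z.2 :=
      hv'.comp (f := fun z : (G × G) × X => (z.1.2, z.2)) (by fun_prop)
    fun_prop)
  set W : X → ℂ := fun x => ∫ g, conj (F g) * v g x ∂ν with hW
  have hWc : Continuous W := continuous_integral_of_compactSpace (by
    change Continuous fun z : X × G => conj (F z.2) * v z.2 z.1
    have h1 : Continuous fun z : X × G => v z.2 z.1 :=
      hv'.comp (f := fun z : X × G => (z.2, z.1)) (by fun_prop)
    fun_prop)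
  set A := ∫ g, ‖F g‖ ^ 2 ∂ν with hA
  have hA0 : 0 ≤ A := integral_nonneg fun g => by positivity
  have h1 : (A : ℂ) = ∫ x, p x * W x ∂μ := by
    calc (A : ℂ) = ∫ g, ((‖F g‖ ^ 2 : ℝ) : ℂ) ∂ν := integral_complex_ofReal.symm
      _ = ∫ g, ∫ x, conj (F g) * (p x * v g x) ∂μ ∂ν := by
          congr 1 with g
          rw [integral_const_mul, ← Complex.normSq_eq_norm_sq, Complex.normSq_eq_conj_mul_self]
      _ = ∫ x, ∫ g, conj (F g) * (p x * v g x) ∂ν ∂μ :=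
          integral_swap_of_compactSpace (by
            change Continuous fun z : G × X => conj (F z.1) * (p z.2 * v z.1 z.2); fun_prop)
      _ = ∫ x, p x * W x ∂μ := by
          congr 1 with x
          rw [hW, ← integral_const_mul]
          congr 1 with g
          ring
  have h2 : A ^ 2 ≤ ∫ x, ‖W x‖ ^ 2 ∂μ := by
    have : A ≤ ∫ x, ‖W x‖ ∂μ := by
      calc A = ‖(A : ℂ)‖ := by rw [Complex.norm_real, Real.norm_of_nonneg hA0]
        _ ≤ ∫ x, ‖p x * W x‖ ∂μ := by rw [h1]; exact norm_integral_le_integral_norm _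
        _ ≤ ∫ x, ‖W x‖ ∂μ := by
          refine integral_mono (Continuous.integrable_of_compactSpace (by fun_prop))
            (Continuous.integrable_of_compactSpace (by fun_prop)) fun x => ?_
          simp only [norm_mul]
          exact mul_le_of_le_one_left (norm_nonneg _) (hp1 x)
    calc A ^ 2 ≤ (∫ x, ‖W x‖ ∂μ) ^ 2 := by gcongr
      _ ≤ _ := sq_integral_le_integral_sq (Continuous.integrable_of_compactSpace (by fun_prop))
        (Continuous.integrable_of_compactSpace (by fun_prop))
  have h3 : ((∫ x, ‖W x‖ ^ 2 ∂μ : ℝ) : ℂ)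
      = ∫ g, ∫ g', conj (F g) * (F g' * K g g') ∂ν ∂ν := by
    have hin : ∀ g, ∫ x, conj (W x) * v g x ∂μ = ∫ g', F g' * K g g' ∂ν := by
      intro g
      have hvg : Continuous (v g) := hv'.comp (f := fun x => (g, x)) (by fun_prop)
      calc ∫ x, conj (W x) * v g x ∂μ
          = ∫ x, ∫ g', F g' * (v g x * conj (v g' x)) ∂ν ∂μ := by
            congr 1 with x
            rw [hW]
            simp only
            rw [← integral_conj, ← integral_mul_const]
            congr 1 with g'
            simp only [map_mul, Complex.conj_conj]
            ring
        _ = ∫ g', ∫ x, F g' * (v g x * conj (v g' x)) ∂μ ∂ν :=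
            integral_swap_of_compactSpace (by
              change Continuous fun z : X × G => F z.2 * (v g z.1 * conj (v z.2 z.1))
              have h1 : Continuous fun z : X × G => v z.2 z.1 :=
                hv'.comp (f := fun z : X × G => (z.2, z.1)) (by fun_prop)
              fun_prop)
        _ = _ := by
            congr 1 with g'
            rw [integral_const_mul]
    calc ((∫ x, ‖W x‖ ^ 2 ∂μ : ℝ) : ℂ) = ∫ x, ((‖W x‖ ^ 2 : ℝ) : ℂ) ∂μ :=
          integral_complex_ofReal.symm
      _ = ∫ x, ∫ g, conj (F g) * (conj (W x) * v g x) ∂ν ∂μ := by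
          congr 1 with x
          rw [← Complex.normSq_eq_norm_sq, Complex.normSq_eq_conj_mul_self]
          conv_lhs => rw [hW]
          simp only
          rw [← integral_const_mul]
          congr 1 with g
          ring
      _ = ∫ g, ∫ x, conj (F g) * (conj (W x) * v g x) ∂μ ∂ν :=
          integral_swap_of_compactSpace (by
            change Continuous fun z : X × G => conj (F z.2) * (conj (W z.1) * v z.2 z.1)
            have h1 : Continuous fun z : X × G => v z.2 z.1 :=
              hv'.comp (f := fun z : X × G => (z.2, z.1)) (by fun_prop)
            fun_prop)
      _ = _ := by
          congr 1 with g
          rw [integral_const_mul, hin, ← integral_const_mul]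
  have hKg : ∀ g, Continuous (K g) := fun g => hKc.comp (f := fun g' => (g, g')) (by fun_prop)
  have hKK : Continuous fun g => ∫ g', ‖K g g'‖ ^ 2 ∂ν := continuous_integral_of_compactSpace (by
    change Continuous fun z : G × G => ‖K z.1 z.2‖ ^ 2; fun_prop)
  -- the arithmetic-geometric mean inequality reproduces `A ^ 2` on the right with weight one half
  have h4 : A ^ 2 ≤ ∫ g, ((‖F g‖ ^ 2 * A + ∫ g', ‖K g g'‖ ^ 2 ∂ν) / 2) ∂ν := by
    have hnn : 0 ≤ ∫ x, ‖W x‖ ^ 2 ∂μ := integral_nonneg fun x => by positivity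
    calc A ^ 2 ≤ ‖((∫ x, ‖W x‖ ^ 2 ∂μ : ℝ) : ℂ)‖ := by
          rwa [Complex.norm_real, Real.norm_of_nonneg hnn]
      _ ≤ _ := by
          rw [h3]
          refine norm_integral_le_of_norm_le (Continuous.integrable_of_compactSpace (by fun_prop))
            (.of_forall fun g => ?_)
          have hKgc := hKg g
          have hi : ∫ g', (‖F g‖ ^ 2 * ‖F g'‖ ^ 2 + ‖K g g'‖ ^ 2) / 2 ∂ν
              = (‖F g‖ ^ 2 * A + ∫ g', ‖K g g'‖ ^ 2 ∂ν) / 2 := by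
            rw [integral_div, integral_add
              (Continuous.integrable_of_compactSpace (by fun_prop))
              (Continuous.integrable_of_compactSpace (by fun_prop)), integral_const_mul]
          rw [← hi]
          refine norm_integral_le_of_norm_le (Continuous.integrable_of_compactSpace (by fun_prop))
            (.of_forall fun g' => ?_)
          simp only [norm_mul, RCLike.norm_conj]
          nlinarith [sq_nonneg (‖F g‖ * ‖F g'‖ - ‖K g g'‖)]
  rw [integral_div, integral_add (Continuous.integrable_of_compactSpace (by fun_prop))
    hKK.integrable_of_compactSpace, integral_mul_const] at h4
  change A ^ 2 ≤ (A * A + ∫ g, ∫ g', ‖K g g'‖ ^ 2 ∂ν ∂ν) / 2 at h4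
  nlinarith

end ContinuousIntegrals

/-! ### The Koopman representation -/

section KoopmanRepresentation

variable {G X : Type*} [Group G] [MeasurableSpace X] {ν : Measure X}

theorem coeFn_koopman (a : G →* Equiv.Perm X) (ha : ∀ g, MeasurePreserving (a g) ν ν) (g : G)
    (f : Lp ℂ 2 ν) : koopman a ha g f =ᵐ[ν] fun x => f (a g⁻¹ x) :=
  Lp.coeFn_compMeasurePreserving f (ha g⁻¹)

/-- The Koopman representation as a homomorphism into the linear isometries of `L²`. -/
noncomputable def koopmanHom (a : G →* Equiv.Perm X) (ha : ∀ g, MeasurePreserving (a g) ν ν) :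
    G →* (Lp ℂ 2 ν →ₗᵢ[ℂ] Lp ℂ 2 ν) where
  toFun := koopman a ha
  map_one' := by
    ext1 f
    apply Lp.ext
    filter_upwards [coeFn_koopman a ha 1 f] with x hx
    simpa using hx
  map_mul' g h := by
    ext1 f
    apply Lp.ext
    have h1 := (ha g⁻¹).quasiMeasurePreserving.ae_eq_comp (coeFn_koopman a ha h f)
    filter_upwards [coeFn_koopman a ha (g * h) f, coeFn_koopman a ha g (koopman a ha h f), h1]
      with x hx hx1 hx2
    rw [hx]
    refine Eq.trans ?_ (hx1.trans hx2).symm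
    simp

@[simp]
theorem koopmanHom_apply (a : G →* Equiv.Perm X) (ha : ∀ g, MeasurePreserving (a g) ν ν) (g : G) :
    koopmanHom a ha g = koopman a ha g := rfl

variable [TopologicalSpace G] [IsTopologicalGroup G] [TopologicalSpace X] [R1Space X]
  [BorelSpace X]

theorem continuous_koopman [IsFiniteMeasure ν] [ν.InnerRegularCompactLTTop] (a : G →* Equiv.Perm X)
    (ha : ∀ g, MeasurePreserving (a g) ν ν) (hc : Continuous fun p : G × X => a p.1 p.2)
    (f : Lp ℂ 2 ν) : Continuous fun g => koopman a ha g f := by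
  let F : C(G, C(X, X)) := ContinuousMap.curry ⟨fun p : G × X => a p.1⁻¹ p.2,
    hc.comp (f := fun p : G × X => (p.1⁻¹, p.2)) (by fun_prop)⟩
  exact (continuous_const (y := f)).compMeasurePreservingLp F.continuous (fun g => ha g⁻¹)
    (by simp)

/-- The projection onto the invariant functions is the average over the group. -/
theorem invariantProj_eq_integral [IsFiniteMeasure ν] [ν.InnerRegularCompactLTTop]
    [CompactSpace G] [MeasurableSpace G] [BorelSpace G] (μ : Measure G) [IsProbabilityMeasure μ]
    [μ.IsMulLeftInvariant] (a : G →* Equiv.Perm X)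
    (ha : ∀ g, MeasurePreserving (a g) ν ν) (hc : Continuous fun p : G × X => a p.1 p.2)
    (f : Lp ℂ 2 ν) : invariantProj a ha f = ∫ g, koopman a ha g f ∂μ := by
  have hπ : ∀ v, Continuous fun g => koopmanHom a ha g v := continuous_koopman a ha hc
  refine Submodule.eq_starProjection_of_mem_of_inner_eq_zero
    ((mem_invariantSubspace a ha _).mpr (representation_integral_orbit hπ f)) fun w hw => ?_
  rw [mem_invariantSubspace] at hw
  rw [← inner_conj_symm, inner_sub_right, map_eq_zero, sub_eq_zero]
  exact (inner_integral_orbit_of_fixed (μ := μ) hπ f hw).symm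

end KoopmanRepresentation

section CompactSpace

variable {G X : Type*} [Group G] [TopologicalSpace X] [CompactSpace X] [MeasurableSpace X]
  [BorelSpace X] {μ : Measure X}

theorem norm_toLp_le [IsProbabilityMeasure μ] {U : ℝ} (f : C(X, ℂ)) (hU : ∀ x, ‖f x‖ ≤ U) :
    ‖ContinuousMap.toLp 2 μ ℂ f‖ ≤ U := by
  have h0 : 0 ≤ U := (norm_nonneg _).trans (hU μ.nonempty_of_neZero.some)
  have := Lp.norm_le_of_ae_bound (f := ContinuousMap.toLp 2 μ ℂ f) h0 (by
    filter_upwards [ContinuousMap.coeFn_toLp (p := 2) (𝕜 := ℂ) μ f] with x hx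
    rw [hx]; exact hU x)
  simpa [measureUnivNNReal] using this

variable [IsFiniteMeasure μ]

theorem koopman_toLp (a : G →* Equiv.Perm X) (ha : ∀ g, MeasurePreserving (a g) μ μ) (g : G)
    (f : C(X, ℂ)) :
    koopman a ha g (ContinuousMap.toLp 2 μ ℂ f) =ᵐ[μ] fun x => f (a g⁻¹ x) :=
  (coeFn_koopman a ha g _).trans
    ((ha g⁻¹).quasiMeasurePreserving.ae_eq_comp (ContinuousMap.coeFn_toLp μ f))

/-- The inner product is conjugate-linear on the left, so bilinear integrals are inner products with
`star u`. -/
theorem inner_toLp_star (u : C(X, ℂ)) (v : Lp ℂ 2 μ) :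
    ⟪ContinuousMap.toLp 2 μ ℂ (star u), v⟫_ℂ = ∫ x, u x * v x ∂μ := by
  rw [L2.inner_def]
  refine integral_congr_ae ?_
  filter_upwards [ContinuousMap.coeFn_toLp (p := 2) (𝕜 := ℂ) μ (star u)] with x hx
  rw [hx, RCLike.inner_apply, mul_comm]
  simp

theorem inner_toLp_koopman_toLp (a : G →* Equiv.Perm X) (ha : ∀ g, MeasurePreserving (a g) μ μ)
    (g : G) (u b : C(X, ℂ)) :
    ⟪ContinuousMap.toLp 2 μ ℂ (star u), koopman a ha g (ContinuousMap.toLp 2 μ ℂ b)⟫_ℂ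
      = ∫ x, u x * b (a g⁻¹ x) ∂μ := by
  rw [inner_toLp_star]
  refine integral_congr_ae ?_
  filter_upwards [koopman_toLp a ha g b] with x hx
  rw [hx]

end CompactSpace

/-! ### Translations and conjugation on a compact group -/

section Actions

/-- The right translation action of a group on itself, `g · x = x * g⁻¹`. -/
def rightTranslation (G : Type*) [Group G] : G →* Equiv.Perm G where
  toFun g := Equiv.mulRight g⁻¹
  map_one' := by ext; simp
  map_mul' g h := by ext; simp [mul_assoc]

@[simp]
theorem leftTranslation_apply {G : Type*} [Group G] (g x : G) : leftTranslation G g x = g * x := rfl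

@[simp]
theorem rightTranslation_apply {G : Type*} [Group G] (g x : G) :
    rightTranslation G g x = x * g⁻¹ := rfl

@[simp]
theorem conjugation_apply {G : Type*} [Group G] (g x : G) : conjugation G g x = g * x * g⁻¹ := rfl

variable {G : Type*} [Group G] [TopologicalSpace G] [IsTopologicalGroup G]

theorem continuous_leftTranslation : Continuous fun p : G × G => leftTranslation G p.1 p.2 := by
  simp only [leftTranslation_apply]; fun_prop

theorem continuous_rightTranslation : Continuous fun p : G × G => rightTranslation G p.1 p.2 := by
  simp only [rightTranslation_apply]; fun_prop

theorem continuous_conjugation : Continuous fun p : G × G => conjugation G p.1 p.2 := by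
  simp only [conjugation_apply]; fun_prop

end Actions

section Haar

variable {G : Type*} [Group G] [TopologicalSpace G] [IsTopologicalGroup G] [CompactSpace G]
  [MeasurableSpace G] [BorelSpace G] (μ : Measure G) [μ.IsHaarMeasure] [IsProbabilityMeasure μ]

/-- Unimodularity: a right translate of `μ` is again a Haar probability measure. -/
theorem isMulRightInvariant_of_compactSpace : μ.IsMulRightInvariant where
  map_mul_right_eq_self g := by
    have : IsProbabilityMeasure (μ.map (· * g)) :=
      Measure.isProbabilityMeasure_map (measurable_mul_const _).aemeasurable
    exact Measure.isHaarMeasure_eq_of_isProbabilityMeasure _ μ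

theorem isInvInvariant_of_compactSpace : μ.IsInvInvariant where
  inv_eq_self := by
    have := isMulRightInvariant_of_compactSpace μ
    have : IsProbabilityMeasure μ.inv :=
      Measure.isProbabilityMeasure_map measurable_inv.aemeasurable
    have : μ.inv.IsHaarMeasure := { toIsOpenPosMeasure :=
      (Homeomorph.inv G).continuous.isOpenPosMeasure_map (Homeomorph.inv G).surjective }
    exact Measure.isHaarMeasure_eq_of_isProbabilityMeasure _ μ

/-- Regularity is not part of the definition of a Haar measure, but holds on a compact group by
uniqueness of the Haar probability measure. -/
theorem regular_of_compactSpace : μ.Regular := by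
  have : IsProbabilityMeasure (Measure.haarMeasure (⊤ : TopologicalSpace.PositiveCompacts G)) :=
    ⟨Measure.haarMeasure_self⟩
  rw [Measure.isHaarMeasure_eq_of_isProbabilityMeasure μ (Measure.haarMeasure ⊤)]
  infer_instance

theorem rightTranslation_measurePreserving (g : G) :
    MeasurePreserving (rightTranslation G g) μ μ := by
  have := isMulRightInvariant_of_compactSpace μ
  exact measurePreserving_mul_right μ g⁻¹

variable {μ}

/-! ### Correlations of continuous functions -/

/-- The variance bound for matrix coefficients of a Koopman representation, for continuous functions
and with suprema in place of `L²` norms. -/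
theorem IsQuasirandom.variance_correlation_le {D : ℝ} (hD : 0 < D) (hG : IsQuasirandom G D)
    (a : G →* Equiv.Perm G) (ha : ∀ g, MeasurePreserving (a g) μ μ)
    (hc : Continuous fun p : G × G => a p.1 p.2) {u b : G → ℂ} (hu : Continuous u)
    (hb : Continuous b) {U B : ℝ} (hU : ∀ x, ‖u x‖ ≤ U) (hB : ∀ x, ‖b x‖ ≤ B) :
    ∫ g, ‖∫ x, u x * b (a g⁻¹ x) ∂μ - ∫ h, ∫ x, u x * b (a h⁻¹ x) ∂μ ∂μ‖ ^ 2 ∂μ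
      ≤ U ^ 2 * B ^ 2 / D := by
  have := regular_of_compactSpace μ
  have h := hG.variance_inner_le (μ := μ) (π := koopmanHom a ha) (continuous_koopman a ha hc) hD
    (ContinuousMap.toLp 2 μ ℂ (star ⟨u, hu⟩)) (ContinuousMap.toLp 2 μ ℂ ⟨b, hb⟩)
  simp only [koopmanHom_apply, inner_toLp_koopman_toLp, ContinuousMap.coe_mk] at h
  refine h.trans ?_
  gcongr
  · exact norm_toLp_le _ (by simpa using hU)
  · exact norm_toLp_le _ hB

theorem IsQuasirandom.variance_left_le {D : ℝ} (hD : 0 < D) (hG : IsQuasirandom G D)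
    {u b : G → ℂ} (hu : Continuous u)
    (hb : Continuous b) {U B : ℝ} (hU : ∀ x, ‖u x‖ ≤ U) (hB : ∀ x, ‖b x‖ ≤ B) :
    ∫ g, ‖∫ x, u x * b (g⁻¹ * x) ∂μ - (∫ x, u x ∂μ) * ∫ x, b x ∂μ‖ ^ 2 ∂μ
      ≤ U ^ 2 * B ^ 2 / D := by
  have h := hG.variance_correlation_le hD _ (leftTranslation_measurePreserving μ)
    continuous_leftTranslation hu hb hU hB
  have := isMulRightInvariant_of_compactSpace μ
  have := isInvInvariant_of_compactSpace μ
  have e : ∫ h, ∫ x, u x * b (h⁻¹ * x) ∂μ ∂μ = (∫ x, u x ∂μ) * ∫ x, b x ∂μ := by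
    rw [integral_swap_of_compactSpace (by
      change Continuous fun z : G × G => u z.2 * b (z.1⁻¹ * z.2); fun_prop), ← integral_mul_const]
    congr 1 with x
    rw [integral_const_mul, integral_inv_eq_self (fun h => b (h * x)),
      integral_mul_right_eq_self]
  simp only [leftTranslation_apply, e] at h
  exact h

theorem IsQuasirandom.variance_right_le {D : ℝ} (hD : 0 < D) (hG : IsQuasirandom G D)
    {u b : G → ℂ} (hu : Continuous u)
    (hb : Continuous b) {U B : ℝ} (hU : ∀ x, ‖u x‖ ≤ U) (hB : ∀ x, ‖b x‖ ≤ B) :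
    ∫ g, ‖∫ x, u x * b (x * g) ∂μ - (∫ x, u x ∂μ) * ∫ x, b x ∂μ‖ ^ 2 ∂μ
      ≤ U ^ 2 * B ^ 2 / D := by
  have h := hG.variance_correlation_le hD _ (rightTranslation_measurePreserving μ)
    continuous_rightTranslation hu hb hU hB
  have e : ∫ h, ∫ x, u x * b (x * h) ∂μ ∂μ = (∫ x, u x ∂μ) * ∫ x, b x ∂μ := by
    rw [integral_swap_of_compactSpace (by
      change Continuous fun z : G × G => u z.2 * b (z.2 * z.1); fun_prop), ← integral_mul_const]
    congr 1 with x
    rw [integral_const_mul, integral_mul_left_eq_self]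
  simp only [rightTranslation_apply, inv_inv, e] at h
  exact h

/-- The contribution of a function `q` of mean zero: by van der Corput's inequality the mean square
of the triple correlation is controlled by correlations under right translations of
`x ↦ q x * conj (q (h⁻¹ * x))` and `x ↦ r x * conj (r (h⁻¹ * x * h))`, which are small unless the
mean of the former is large, and that mean is itself a left correlation of `q`. -/
theorem IsQuasirandom.sq_integral_triple_correlation_le {D : ℝ} (hD : 0 < D)
    (hG : IsQuasirandom G D) {p q r : G → ℂ} (hp : Continuous p) (hq : Continuous q)
    (hr : Continuous r) (hp1 : ∀ x, ‖p x‖ ≤ 1) (hq2 : ∀ x, ‖q x‖ ≤ 2) (hr1 : ∀ x, ‖r x‖ ≤ 1)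
    (hq0 : ∫ x, q x ∂μ = 0) :
    (∫ g, ‖∫ x, p x * (q (g⁻¹ * x) * r (g⁻¹ * x * g)) ∂μ‖ ^ 2 ∂μ) ^ 2 ≤ 64 / D := by
  refine (sq_integral_norm_sq_le_gram (v := fun g x => q (g⁻¹ * x) * r (g⁻¹ * x * g)) hp hp1 (by
    change Continuous fun z : G × G => q (z.1⁻¹ * z.2) * r (z.1⁻¹ * z.2 * z.1); fun_prop)).trans ?_
  set a : G → G → ℂ := fun h x => q x * conj (q (h⁻¹ * x)) with ha
  set b : G → G → ℂ := fun h x => r x * conj (r (h⁻¹ * x * h)) with hb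
  have hac : Continuous fun z : G × G => a z.1 z.2 := by simp only [ha]; fun_prop
  have hbc : Continuous fun z : G × G => b z.1 z.2 := by simp only [hb]; fun_prop
  have ha1 : ∀ h x, ‖a h x‖ ≤ 4 := fun h x => by
    simp only [ha, norm_mul, RCLike.norm_conj]
    nlinarith [hq2 x, hq2 (h⁻¹ * x), norm_nonneg (q x), norm_nonneg (q (h⁻¹ * x))]
  have hb1 : ∀ h x, ‖b h x‖ ≤ 1 := fun h x => by
    simp only [hb, norm_mul, RCLike.norm_conj]
    exact mul_le_one₀ (hr1 _) (norm_nonneg _) (hr1 _)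
  -- the substitutions `g' = g * h` and then `x ↦ g * x`
  have hshift : ∀ g, ∫ g', ‖∫ x, q (g⁻¹ * x) * r (g⁻¹ * x * g)
      * conj (q (g'⁻¹ * x) * r (g'⁻¹ * x * g')) ∂μ‖ ^ 2 ∂μ
      = ∫ h, ‖∫ x, a h x * b h (x * g) ∂μ‖ ^ 2 ∂μ := by
    intro g
    rw [← integral_mul_left_eq_self (μ := μ) _ g]
    congr 1 with h
    rw [← integral_mul_left_eq_self (μ := μ) _ g]
    congr 3 with x
    simp only [ha, hb, map_mul]
    simp only [mul_inv_rev, mul_assoc, inv_mul_cancel_left]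
    ring
  simp_rw [hshift]
  have hKc : Continuous fun z : G × G => ∫ x, a z.2 x * b z.2 (x * z.1) ∂μ :=
    continuous_integral_of_compactSpace (by
      change Continuous fun z : (G × G) × G => a z.1.2 z.2 * b z.1.2 (z.2 * z.1.1)
      have h1 : Continuous fun z : (G × G) × G => a z.1.2 z.2 :=
        hac.comp (f := fun z : (G × G) × G => (z.1.2, z.2)) (by fun_prop)
      have h2 : Continuous fun z : (G × G) × G => b z.1.2 (z.2 * z.1.1) :=
        hbc.comp (f := fun z : (G × G) × G => (z.1.2, z.2 * z.1.1)) (by fun_prop)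
      fun_prop)
  rw [integral_swap_of_compactSpace (by
    change Continuous fun z : G × G => ‖∫ x, a z.2 x * b z.2 (x * z.1) ∂μ‖ ^ 2; fun_prop)]
  have hmc : Continuous fun h => ∫ x, a h x ∂μ := continuous_integral_of_compactSpace hac
  have hinner : ∀ h, ∫ g, ‖∫ x, a h x * b h (x * g) ∂μ‖ ^ 2 ∂μ
      ≤ 2 * ‖∫ x, a h x ∂μ‖ ^ 2 + 32 / D := by
    intro h
    have hah : Continuous (a h) := hac.comp (f := fun x => (h, x)) (by fun_prop)
    have hbh : Continuous (b h) := hbc.comp (f := fun x => (h, x)) (by fun_prop)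
    have hKh : Continuous fun g => ∫ x, a h x * b h (x * g) ∂μ :=
      hKc.comp (f := fun g => (g, h)) (by fun_prop)
    have hv := hG.variance_right_le (μ := μ) hD hah hbh (ha1 h) (hb1 h)
    set m := (∫ x, a h x ∂μ) * ∫ x, b h x ∂μ with hm
    have hbm : ‖∫ x, b h x ∂μ‖ ≤ 1 := by
      simpa using norm_integral_le_of_norm_le_const (μ := μ) (.of_forall (hb1 h))
    have hmle : ‖m‖ ^ 2 ≤ ‖∫ x, a h x ∂μ‖ ^ 2 := by
      gcongr
      rw [hm, norm_mul]
      exact mul_le_of_le_one_right (norm_nonneg _) hbm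
    calc ∫ g, ‖∫ x, a h x * b h (x * g) ∂μ‖ ^ 2 ∂μ
        ≤ ∫ g, (2 * ‖∫ x, a h x * b h (x * g) ∂μ - m‖ ^ 2 + 2 * ‖m‖ ^ 2) ∂μ := by
          refine integral_mono (Continuous.integrable_of_compactSpace (by fun_prop))
            (Continuous.integrable_of_compactSpace (by fun_prop)) fun g => ?_
          have := norm_add_le (∫ x, a h x * b h (x * g) ∂μ - m) m
          rw [sub_add_cancel] at this
          have h2 := pow_le_pow_left₀ (norm_nonneg _) this 2
          simp only
          nlinarith [sq_nonneg (‖∫ x, a h x * b h (x * g) ∂μ - m‖ - ‖m‖)]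
      _ = 2 * ∫ g, ‖∫ x, a h x * b h (x * g) ∂μ - m‖ ^ 2 ∂μ + 2 * ‖m‖ ^ 2 := by
          rw [integral_add (Continuous.integrable_of_compactSpace (by fun_prop))
            (integrable_const _), integral_const_mul]
          simp
      _ ≤ 2 * (4 ^ 2 * 1 ^ 2 / D) + 2 * ‖∫ x, a h x ∂μ‖ ^ 2 := by gcongr
      _ = _ := by ring
  have hleft := hG.variance_left_le (μ := μ) (u := q) (b := fun x => conj (q x)) hD hq
    (by fun_prop) hq2 (B := 2) (by simpa using hq2)
  simp only [hq0, zero_mul, sub_zero] at hleft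
  calc _ ≤ ∫ h, (2 * ‖∫ x, a h x ∂μ‖ ^ 2 + 32 / D) ∂μ := by
        refine integral_mono (Continuous.integrable_of_compactSpace ?_)
          (Continuous.integrable_of_compactSpace (by fun_prop)) hinner
        exact continuous_integral_of_compactSpace (by
          change Continuous fun z : G × G => ‖∫ x, a z.1 x * b z.1 (x * z.2) ∂μ‖ ^ 2
          exact ((hKc.comp (f := fun z : G × G => (z.2, z.1)) (by fun_prop)).norm).pow 2)
    _ = 2 * ∫ h, ‖∫ x, a h x ∂μ‖ ^ 2 ∂μ + 32 / D := by
        rw [integral_add (Continuous.integrable_of_compactSpace (by fun_prop))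
          (integrable_const _), integral_const_mul]
        simp
    _ ≤ 2 * (2 ^ 2 * 2 ^ 2 / D) + 32 / D := by gcongr
    _ = 64 / D := by ring

/-- The recurrence estimate for continuous functions. -/
theorem IsQuasirandom.integral_triple_correlation_le {D : ℝ} (hD : 1 ≤ D) (hG : IsQuasirandom G D)
    {f₁ f₂ f₃ : G → ℂ} (h₁ : Continuous f₁) (h₂ : Continuous f₂) (h₃ : Continuous f₃)
    (hb₁ : ∀ x, ‖f₁ x‖ ≤ 1) (hb₂ : ∀ x, ‖f₂ x‖ ≤ 1) (hb₃ : ∀ x, ‖f₃ x‖ ≤ 1) :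
    ∫ g, ‖∫ x, f₁ x * f₂ (g⁻¹ * x) * f₃ (g⁻¹ * x * g) ∂μ
      - (∫ x, f₂ x ∂μ) * ∫ h, ∫ x, f₁ x * f₃ (h⁻¹ * x * h) ∂μ ∂μ‖ ∂μ
      ≤ 4 * D ^ (-(1 / 4) : ℝ) := by
  have hD0 : 0 < D := by linarith
  set t := D ^ (-(1 / 4) : ℝ) with ht
  have ht0 : 0 < t := Real.rpow_pos_of_pos hD0 _
  have ht1 : t ≤ 1 := Real.rpow_le_one_of_one_le_of_nonpos hD (by norm_num)
  have ht4 : t ^ 4 = 1 / D := by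
    rw [ht, ← Real.rpow_natCast, ← Real.rpow_mul hD0.le]
    norm_num
    exact Real.rpow_neg_one D
  set m := ∫ x, f₂ x ∂μ with hm
  have hm1 : ‖m‖ ≤ 1 := by
    simpa using norm_integral_le_of_norm_le_const (μ := μ) (.of_forall hb₂)
  set F : G → ℂ := fun g => ∫ x, f₁ x * ((f₂ (g⁻¹ * x) - m) * f₃ (g⁻¹ * x * g)) ∂μ with hF
  set C : G → ℂ := fun g => ∫ x, f₁ x * f₃ (g⁻¹ * x * g) ∂μ with hC
  have hFc : Continuous F := continuous_integral_of_compactSpace (by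
    change Continuous fun z : G × G =>
      f₁ z.2 * ((f₂ (z.1⁻¹ * z.2) - m) * f₃ (z.1⁻¹ * z.2 * z.1))
    fun_prop)
  have hCc : Continuous C := continuous_integral_of_compactSpace (by
    change Continuous fun z : G × G => f₁ z.2 * f₃ (z.1⁻¹ * z.2 * z.1)
    fun_prop)
  have hdec : ∀ g, ∫ x, f₁ x * f₂ (g⁻¹ * x) * f₃ (g⁻¹ * x * g) ∂μ - m * ∫ h, C h ∂μ
      = F g + m * (C g - ∫ h, C h ∂μ) := by
    intro g
    have : ∫ x, f₁ x * f₂ (g⁻¹ * x) * f₃ (g⁻¹ * x * g) ∂μ = F g + m * C g := by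
      rw [hF, hC, ← integral_const_mul, ← integral_add
        (Continuous.integrable_of_compactSpace (by fun_prop))
        (Continuous.integrable_of_compactSpace (by fun_prop))]
      congr 1 with x
      ring
    rw [this]; ring
  have hA : (∫ g, ‖F g‖ ^ 2 ∂μ) ^ 2 ≤ 64 / D := by
    refine hG.sq_integral_triple_correlation_le (μ := μ) (q := fun x => f₂ x - m) hD0 h₁
      (by fun_prop) h₃ hb₁ (fun x => ?_) hb₃ ?_
    · exact (norm_sub_le _ _).trans (by linarith [hb₂ x])
    · rw [integral_sub h₂.integrable_of_compactSpace (integrable_const _)]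
      simp [hm]
  -- with `t = D ^ (-1/4)` the two parts contribute `√8 * t ≤ 3 * t` and `t ^ 2 ≤ t`
  have hA1 : ∫ g, ‖F g‖ ^ 2 ∂μ ≤ 8 * t ^ 2 := by
    refine abs_le_of_sq_le_sq' ?_ (by positivity) |>.2
    rw [show (8 * t ^ 2) ^ 2 = 64 * t ^ 4 by ring, ht4]
    linarith [hA, mul_one_div 64 D]
  have hF1 : ∫ g, ‖F g‖ ∂μ ≤ 3 * t := by
    refine abs_le_of_sq_le_sq' ?_ (by positivity) |>.2
    have := sq_integral_le_integral_sq (μ := μ) (w := fun g => ‖F g‖)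
      (Continuous.integrable_of_compactSpace (by fun_prop))
      (Continuous.integrable_of_compactSpace (by fun_prop))
    nlinarith [sq_nonneg t]
  have hV : ∫ g, ‖C g - ∫ h, C h ∂μ‖ ^ 2 ∂μ ≤ 1 / D := by
    have h := hG.variance_correlation_le hD0 _ (conjugation_measurePreserving μ)
      continuous_conjugation h₁ h₃ hb₁ hb₃
    simpa only [conjugation_apply, inv_inv, one_pow, mul_one] using h
  have hC1 : ∫ g, ‖C g - ∫ h, C h ∂μ‖ ∂μ ≤ t ^ 2 := by
    refine abs_le_of_sq_le_sq' ?_ (by positivity) |>.2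
    rw [← pow_mul, ht4]
    exact (sq_integral_le_integral_sq (μ := μ)
      (Continuous.integrable_of_compactSpace (by fun_prop))
      (Continuous.integrable_of_compactSpace (by fun_prop))).trans hV
  calc _ = ∫ g, ‖F g + m * (C g - ∫ h, C h ∂μ)‖ ∂μ := by
        congr 1 with g
        rw [← hdec]
    _ ≤ ∫ g, (‖F g‖ + ‖C g - ∫ h, C h ∂μ‖) ∂μ := by
        refine integral_mono (Continuous.integrable_of_compactSpace (by fun_prop))
          (Continuous.integrable_of_compactSpace (by fun_prop)) fun g => ?_
        refine (norm_add_le _ _).trans ?_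
        gcongr
        rw [norm_mul]
        exact mul_le_of_le_one_left (norm_nonneg _) hm1
    _ = ∫ g, ‖F g‖ ∂μ + ∫ g, ‖C g - ∫ h, C h ∂μ‖ ∂μ :=
        integral_add (Continuous.integrable_of_compactSpace (by fun_prop))
          (Continuous.integrable_of_compactSpace (by fun_prop))
    _ ≤ 3 * t + t ^ 2 := by gcongr
    _ ≤ 4 * t := by nlinarith

end Haar

/-! ### Functions in `L²` bounded by one -/

section BoundedFunctions

variable {X : Type*} [MeasurableSpace X] {μ : Measure X}

theorem ae_norm_le_one_of_eLpNorm_top_le {f : X → ℂ} (hf : eLpNorm f ∞ μ ≤ 1) :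
    ∀ᵐ x ∂μ, ‖f x‖ ≤ 1 := by
  rw [eLpNorm_exponent_top] at hf
  filter_upwards [ae_le_eLpNormEssSup (f := f) (μ := μ)] with x hx
  have := hx.trans hf
  rwa [← ofReal_norm, ENNReal.ofReal_le_one] at this

variable (μ) in
/-- The set of functions in `L²` that are bounded by `1` almost everywhere. -/
def unitBoundedSet : Set (Lp ℂ 2 μ) := {f | ∀ᵐ x ∂μ, ‖f x‖ ≤ 1}

theorem convex_unitBoundedSet : Convex ℝ (unitBoundedSet μ) := by
  intro f hf k hk s t hs ht hst
  simp only [unitBoundedSet, Set.mem_ofPred_eq] at *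
  filter_upwards [hf, hk, Lp.coeFn_add (s • f) (t • k), Lp.coeFn_smul s f, Lp.coeFn_smul t k]
    with x hfx hkx h1 h2 h3
  rw [h1, Pi.add_apply, h2, h3, Pi.smul_apply, Pi.smul_apply]
  refine (norm_add_le _ _).trans ?_
  rw [norm_smul, norm_smul, Real.norm_of_nonneg hs, Real.norm_of_nonneg ht]
  nlinarith

theorem isClosed_unitBoundedSet : IsClosed (unitBoundedSet μ) := by
  refine IsSeqClosed.isClosed fun f k hf hlim => ?_
  obtain ⟨ns, -, hns⟩ := (tendstoInMeasure_of_tendsto_Lp hlim).exists_seq_tendsto_ae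
  have hall : ∀ᵐ x ∂μ, ∀ n, ‖f n x‖ ≤ 1 := ae_all_iff.mpr hf
  simp only [unitBoundedSet, Set.mem_ofPred_eq]
  filter_upwards [hns, hall] with x hx hb
  exact le_of_tendsto hx.norm (.of_forall fun n => hb _)

theorem koopman_mem_unitBoundedSet {G : Type*} [Group G] (a : G →* Equiv.Perm X)
    (ha : ∀ g, MeasurePreserving (a g) μ μ) (g : G) {f : Lp ℂ 2 μ} (hf : f ∈ unitBoundedSet μ) :
    koopman a ha g f ∈ unitBoundedSet μ := by
  simp only [unitBoundedSet, Set.mem_ofPred_eq] at *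
  filter_upwards [coeFn_koopman a ha g f, (ha g⁻¹).quasiMeasurePreserving.ae hf] with x hx h
  rwa [hx]

/-- The projection is an average of Koopman translates, each of which is bounded by `1`. -/
theorem invariantProj_mem_unitBoundedSet {G : Type*} [Group G] [TopologicalSpace G]
    [IsTopologicalGroup G] [CompactSpace G] [MeasurableSpace G] [BorelSpace G]
    [TopologicalSpace X] [R1Space X] [BorelSpace X] [IsFiniteMeasure μ]
    [μ.InnerRegularCompactLTTop] (ν : Measure G) [IsProbabilityMeasure ν] [ν.IsMulLeftInvariant]
    (a : G →* Equiv.Perm X) (ha : ∀ g, MeasurePreserving (a g) μ μ)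
    (hc : Continuous fun p : G × X => a p.1 p.2) {f : Lp ℂ 2 μ} (hf : f ∈ unitBoundedSet μ) :
    invariantProj a ha f ∈ unitBoundedSet μ := by
  rw [invariantProj_eq_integral ν a ha hc]
  exact convex_unitBoundedSet.integral_mem isClosed_unitBoundedSet
    (.of_forall fun g => koopman_mem_unitBoundedSet a ha g hf)
    (continuous_koopman a ha hc f).integrable_of_compactSpace

variable [IsProbabilityMeasure μ]

theorem integral_norm_le_norm (f : Lp ℂ 2 μ) : ∫ x, ‖f x‖ ∂μ ≤ ‖f‖ := by
  have hm : MemLp f 2 μ := Lp.memLp f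
  have h1 : Integrable (fun x => ‖f x‖) μ := (hm.integrable one_le_two).norm
  have h2 : Integrable (fun x => ‖f x‖ ^ 2) μ := hm.integrable_norm_pow two_ne_zero
  refine abs_le_of_sq_le_sq' ((sq_integral_le_integral_sq h1 h2).trans ?_) (norm_nonneg _) |>.2
  have h := inner_self_eq_norm_sq_to_K (𝕜 := ℂ) f
  rw [L2.inner_def] at h
  have e : ∫ x, ⟪f x, f x⟫_ℂ ∂μ = ((∫ x, ‖f x‖ ^ 2 ∂μ : ℝ) : ℂ) := by
    rw [← integral_complex_ofReal]
    congr 1 with x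
    rw [inner_self_eq_norm_sq_to_K]
    simp
  rw [e] at h
  exact le_of_eq (Complex.ofReal_injective (h.trans (by simp)))

theorem integrable_triple_product {a b c : Lp ℂ 2 μ} (ha : a ∈ unitBoundedSet μ)
    (hb : b ∈ unitBoundedSet μ) (hc : c ∈ unitBoundedSet μ) :
    Integrable (fun x => a x * b x * c x) μ := by
  refine Integrable.of_bound (((Lp.aestronglyMeasurable a).mul (Lp.aestronglyMeasurable b)).mul
    (Lp.aestronglyMeasurable c)) 1 ?_
  filter_upwards [ha, hb, hc] with x h1 h2 h3
  rw [norm_mul, norm_mul]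
  exact mul_le_one₀ (mul_le_one₀ h1 (norm_nonneg _) h2) (norm_nonneg _) h3

theorem norm_integral_triple_sub_le {a b c a' b' c' : Lp ℂ 2 μ} (ha : a ∈ unitBoundedSet μ)
    (hb : b ∈ unitBoundedSet μ) (hc : c ∈ unitBoundedSet μ) (ha' : a' ∈ unitBoundedSet μ)
    (hb' : b' ∈ unitBoundedSet μ) (hc' : c' ∈ unitBoundedSet μ) :
    ‖∫ x, a x * b x * c x ∂μ - ∫ x, a' x * b' x * c' x ∂μ‖
      ≤ ‖a - a'‖ + ‖b - b'‖ + ‖c - c'‖ := by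
  have hi : ∀ f : Lp ℂ 2 μ, Integrable (fun x => ‖f x‖) μ := fun f =>
    ((Lp.memLp f).integrable one_le_two).norm
  rw [← integral_sub (integrable_triple_product ha hb hc) (integrable_triple_product ha' hb' hc')]
  calc _ ≤ ∫ x, (‖(a - a') x‖ + ‖(b - b') x‖ + ‖(c - c') x‖) ∂μ := by
        refine norm_integral_le_of_norm_le (((hi _).add (hi _)).add (hi _)) ?_
        filter_upwards [ha', hb, hb', hc, Lp.coeFn_sub a a', Lp.coeFn_sub b b',
          Lp.coeFn_sub c c'] with x h1 h2 h3 h4 e1 e2 e3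
        rw [e1, e2, e3]
        simp only [Pi.sub_apply]
        have e : a x * b x * c x - a' x * b' x * c' x
            = (a x - a' x) * (b x * c x) + (b x - b' x) * (a' x * c x)
              + (c x - c' x) * (a' x * b' x) := by ring
        rw [e]
        refine (norm_add₃_le).trans ?_
        simp only [norm_mul]
        gcongr
        · exact mul_le_of_le_one_right (norm_nonneg _) (mul_le_one₀ h2 (norm_nonneg _) h4)
        · exact mul_le_of_le_one_right (norm_nonneg _) (mul_le_one₀ h1 (norm_nonneg _) h4)
        · exact mul_le_of_le_one_right (norm_nonneg _) (mul_le_one₀ h1 (norm_nonneg _) h3)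
    _ = ∫ x, ‖(a - a') x‖ ∂μ + ∫ x, ‖(b - b') x‖ ∂μ + ∫ x, ‖(c - c') x‖ ∂μ := by
        have hab : Integrable (fun x => ‖(a - a') x‖ + ‖(b - b') x‖) μ := (hi _).add (hi _)
        rw [integral_add hab (hi _), integral_add (hi _) (hi _)]
    _ ≤ _ := by gcongr <;> exact integral_norm_le_norm _

end BoundedFunctions

/-- Radial truncation to the closed unit disc at most doubles the distance to a point of the
disc. -/
theorem norm_sub_truncate_le {z w : ℂ} (hz : ‖z‖ ≤ 1) :
    ‖z - ((max 1 ‖w‖)⁻¹ : ℝ) • w‖ ≤ 2 * ‖z - w‖ := by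
  set s := max 1 ‖w‖ with hs
  have hs1 : 1 ≤ s := le_max_left _ _
  have h1 : ‖w - (s⁻¹ : ℝ) • w‖ ≤ ‖z - w‖ := by
    have e : w - (s⁻¹ : ℝ) • w = (1 - s⁻¹ : ℝ) • w := by rw [sub_smul, one_smul]
    have hinv : s⁻¹ ≤ 1 := inv_le_one_of_one_le₀ hs1
    rw [e, norm_smul, Real.norm_of_nonneg (by linarith)]
    have hws : ‖w‖ ≤ s := le_max_right _ _
    have hw : ‖w‖ ≤ ‖z - w‖ + ‖z‖ := by
      have := norm_sub_norm_le w z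
      rw [norm_sub_rev] at this
      linarith
    have h2 : (1 - s⁻¹) * ‖w‖ ≤ s - 1 := by
      calc (1 - s⁻¹) * ‖w‖ ≤ (1 - s⁻¹) * s := by gcongr
        _ = s - 1 := by field_simp
    rcases le_total 1 ‖w‖ with h | h
    · rw [hs, max_eq_right h] at h2 ⊢
      linarith
    · rw [hs, max_eq_left h] at h2 ⊢
      linarith [norm_nonneg (z - w)]
  calc _ = ‖(z - w) + (w - (s⁻¹ : ℝ) • w)‖ := by rw [sub_add_sub_cancel]
    _ ≤ _ := (norm_add_le _ _).trans (by linarith)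

section CompactSpace

variable {X : Type*} [TopologicalSpace X] [CompactSpace X] [MeasurableSpace X] [BorelSpace X]
  {μ : Measure X}

theorem toLp_mem_unitBoundedSet [IsFiniteMeasure μ] {f : C(X, ℂ)} (hf : ∀ x, ‖f x‖ ≤ 1) :
    ContinuousMap.toLp 2 μ ℂ f ∈ unitBoundedSet μ := by
  simp only [unitBoundedSet, Set.mem_ofPred_eq]
  filter_upwards [ContinuousMap.coeFn_toLp (p := 2) (𝕜 := ℂ) μ f] with x hx
  rw [hx]; exact hf x

theorem exists_continuous_norm_sub_toLp_le [NormalSpace X] [IsFiniteMeasure μ] [μ.WeaklyRegular]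
    {f : Lp ℂ 2 μ} (hf : f ∈ unitBoundedSet μ) {ε : ℝ} (hε : 0 < ε) :
    ∃ k : C(X, ℂ), (∀ x, ‖k x‖ ≤ 1) ∧ ‖f - ContinuousMap.toLp 2 μ ℂ k‖ ≤ ε := by
  obtain ⟨w, hw⟩ := (ContinuousMap.toLp_denseRange ℂ μ ℂ (p := 2) (by simp)).exists_dist_lt f
    (half_pos hε)
  rw [dist_eq_norm] at hw
  have hpos : ∀ x, 0 < max 1 ‖w x‖ := fun x => lt_max_of_lt_left one_pos
  let k : C(X, ℂ) := ⟨fun x => ((max 1 ‖w x‖)⁻¹ : ℝ) • w x, by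
    have : Continuous fun x => (max 1 ‖w x‖)⁻¹ :=
      Continuous.inv₀ (by fun_prop) fun x => (hpos x).ne'
    fun_prop⟩
  refine ⟨k, fun x => ?_, ?_⟩
  · simp only [k, ContinuousMap.coe_mk, norm_smul, norm_inv]
    rw [Real.norm_of_nonneg (hpos x).le, inv_mul_le_one₀ (hpos x)]
    exact le_max_right _ _
  · have : ‖f - ContinuousMap.toLp 2 μ ℂ k‖ ≤ 2 * ‖f - ContinuousMap.toLp 2 μ ℂ w‖ := by
      refine Lp.norm_le_mul_norm_of_ae_le_mul ?_
      filter_upwards [hf, Lp.coeFn_sub f (ContinuousMap.toLp 2 μ ℂ k),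
        Lp.coeFn_sub f (ContinuousMap.toLp 2 μ ℂ w),
        ContinuousMap.coeFn_toLp (p := 2) (𝕜 := ℂ) μ k,
        ContinuousMap.coeFn_toLp (p := 2) (𝕜 := ℂ) μ w] with x h1 h2 h3 h4 h5
      rw [h2, h3, Pi.sub_apply, Pi.sub_apply, h4, h5]
      exact norm_sub_truncate_le h1
    linarith

theorem invariantProj_toLp {G : Type*} [Group G] [TopologicalSpace G]
    [IsTopologicalGroup G] [CompactSpace G] [MeasurableSpace G] [BorelSpace G]
    [R1Space X] [IsFiniteMeasure μ]
    [μ.InnerRegularCompactLTTop] (ν : Measure G) [IsProbabilityMeasure ν] [ν.IsMulLeftInvariant]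
    (a : G →* Equiv.Perm X) (ha : ∀ g, MeasurePreserving (a g) μ μ)
    (hc : Continuous fun p : G × X => a p.1 p.2) (f : C(X, ℂ)) :
    invariantProj a ha (ContinuousMap.toLp 2 μ ℂ f) =ᵐ[μ] fun x => ∫ g, f (a g⁻¹ x) ∂ν := by
  have hc' : Continuous fun p : G × X => f (a p.1⁻¹ p.2) :=
    f.continuous.comp (hc.comp (f := fun p : G × X => (p.1⁻¹, p.2)) (by fun_prop))
  let F : C(G, C(X, ℂ)) := ContinuousMap.curry ⟨fun p : G × X => f (a p.1⁻¹ p.2), hc'⟩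
  have hF : Integrable F ν := F.continuous.integrable_of_compactSpace
  have hk : ∀ g, koopman a ha g (ContinuousMap.toLp 2 μ ℂ f) = ContinuousMap.toLp 2 μ ℂ (F g) := by
    intro g
    apply Lp.ext
    exact (koopman_toLp a ha g f).trans (ContinuousMap.coeFn_toLp μ (F g)).symm
  rw [invariantProj_eq_integral ν a ha hc]
  simp_rw [hk]
  rw [ContinuousLinearMap.integral_comp_comm _ hF]
  filter_upwards [ContinuousMap.coeFn_toLp (p := 2) (𝕜 := ℂ) μ (∫ g, F g ∂ν)] with x hx
  rw [hx, ContinuousMap.integral_apply hF]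
  rfl

end CompactSpace

/-! ### The recurrence error -/

section Recurrence

variable {G : Type*} [Group G] [TopologicalSpace G] [IsTopologicalGroup G] [CompactSpace G]
  [MeasurableSpace G] [BorelSpace G] (μ : Measure G) [μ.IsHaarMeasure] [IsProbabilityMeasure μ]

theorem recurrenceError_toLp (f₁ f₂ f₃ : C(G, ℂ)) (g : G) :
    recurrenceError μ (ContinuousMap.toLp 2 μ ℂ f₁) (ContinuousMap.toLp 2 μ ℂ f₂)
      (ContinuousMap.toLp 2 μ ℂ f₃) g
      = ‖∫ x, f₁ x * f₂ (g⁻¹ * x) * f₃ (g⁻¹ * x * g) ∂μ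
        - (∫ x, f₂ x ∂μ) * ∫ h, ∫ x, f₁ x * f₃ (h⁻¹ * x * h) ∂μ ∂μ‖ := by
  have := regular_of_compactSpace μ
  have := isMulRightInvariant_of_compactSpace μ
  have := isInvInvariant_of_compactSpace μ
  rw [recurrenceError]
  congr 2
  · refine integral_congr_ae ?_
    filter_upwards [ContinuousMap.coeFn_toLp (p := 2) (𝕜 := ℂ) μ f₁,
      koopman_toLp _ (leftTranslation_measurePreserving μ) g f₂,
      koopman_toLp _ (conjugation_measurePreserving μ) g f₃] with x h1 h2 h3
    rw [leftKoopman, conjKoopman, h1, h2, h3]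
    simp only [leftTranslation_apply, conjugation_apply, inv_inv]
  · have e : ∀ x, ∫ h, f₂ (h⁻¹ * x) ∂μ = ∫ h, f₂ h ∂μ := fun x => by
      rw [integral_inv_eq_self (fun h => f₂ (h * x)), integral_mul_right_eq_self]
    calc _ = ∫ x, (∫ y, f₂ y ∂μ) * ∫ h, f₁ x * f₃ (h⁻¹ * x * h) ∂μ ∂μ := by
          refine integral_congr_ae ?_
          filter_upwards [ContinuousMap.coeFn_toLp (p := 2) (𝕜 := ℂ) μ f₁,
            invariantProj_toLp μ _ (leftTranslation_measurePreserving μ)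
              continuous_leftTranslation f₂,
            invariantProj_toLp μ _ (conjugation_measurePreserving μ)
              continuous_conjugation f₃] with x h1 h2 h3
          rw [leftProj, conjProj, h1, h2, h3]
          simp only [leftTranslation_apply, conjugation_apply, inv_inv, e, integral_const_mul]
          ring
      _ = _ := by
          rw [integral_const_mul, integral_swap_of_compactSpace]
          change Continuous fun z : G × G => f₁ z.1 * f₃ (z.2⁻¹ * z.1 * z.2)
          fun_prop

variable {μ}

theorem abs_recurrenceError_sub_le {f₁ f₂ f₃ k₁ k₂ k₃ : Lp ℂ 2 μ} (hf₁ : f₁ ∈ unitBoundedSet μ)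
    (hf₂ : f₂ ∈ unitBoundedSet μ) (hf₃ : f₃ ∈ unitBoundedSet μ) (hk₁ : k₁ ∈ unitBoundedSet μ)
    (hk₂ : k₂ ∈ unitBoundedSet μ) (hk₃ : k₃ ∈ unitBoundedSet μ) (g : G) :
    |recurrenceError μ f₁ f₂ f₃ g - recurrenceError μ k₁ k₂ k₃ g|
      ≤ 2 * (‖f₁ - k₁‖ + ‖f₂ - k₂‖ + ‖f₃ - k₃‖) := by
  have := regular_of_compactSpace μ
  rw [recurrenceError, recurrenceError]
  refine (abs_norm_sub_norm_le _ _).trans ?_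
  rw [sub_sub_sub_comm]
  refine (norm_sub_le _ _).trans ?_
  rw [two_mul]
  refine add_le_add ?_ ?_
  · refine (norm_integral_triple_sub_le hf₁ (koopman_mem_unitBoundedSet _ _ g hf₂)
      (koopman_mem_unitBoundedSet _ _ g hf₃) hk₁ (koopman_mem_unitBoundedSet _ _ g hk₂)
      (koopman_mem_unitBoundedSet _ _ g hk₃)).trans_eq ?_
    rw [← map_sub, ← map_sub, LinearIsometry.norm_map, LinearIsometry.norm_map]
  · have hl : ∀ {f}, f ∈ unitBoundedSet μ → leftProj μ f ∈ unitBoundedSet μ := fun hf =>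
      invariantProj_mem_unitBoundedSet μ _ _ continuous_leftTranslation hf
    have hc : ∀ {f}, f ∈ unitBoundedSet μ → conjProj μ f ∈ unitBoundedSet μ := fun hf =>
      invariantProj_mem_unitBoundedSet μ _ _ continuous_conjugation hf
    refine (norm_integral_triple_sub_le hf₁ (hl hf₂) (hc hf₃) hk₁ (hl hk₂) (hc hk₃)).trans ?_
    simp only [leftProj, conjProj]
    rw [← map_sub, ← map_sub]
    gcongr <;> exact Submodule.norm_starProjection_apply_le _ _

theorem continuous_recurrenceError {f₁ f₂ f₃ : Lp ℂ 2 μ} (hf₁ : f₁ ∈ unitBoundedSet μ)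
    (hf₂ : f₂ ∈ unitBoundedSet μ) (hf₃ : f₃ ∈ unitBoundedSet μ) :
    Continuous (recurrenceError μ f₁ f₂ f₃) := by
  have := regular_of_compactSpace μ
  refine Continuous.norm (Continuous.sub ?_ continuous_const)
  have hl : Continuous fun g => leftKoopman μ g f₂ :=
    continuous_koopman _ _ continuous_leftTranslation f₂
  have hc : Continuous fun g => conjKoopman μ g f₃ :=
    continuous_koopman _ _ continuous_conjugation f₃
  refine continuous_iff_continuousAt.mpr fun g₀ => tendsto_iff_norm_sub_tendsto_zero.mpr ?_
  refine squeeze_zero (fun _ => norm_nonneg _) (fun g => norm_integral_triple_sub_le hf₁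
    (koopman_mem_unitBoundedSet _ _ g hf₂) (koopman_mem_unitBoundedSet _ _ g hf₃) hf₁
    (koopman_mem_unitBoundedSet _ _ g₀ hf₂) (koopman_mem_unitBoundedSet _ _ g₀ hf₃)) ?_
  have h : Continuous fun g => ‖f₁ - f₁‖ + ‖leftKoopman μ g f₂ - leftKoopman μ g₀ f₂‖
      + ‖conjKoopman μ g f₃ - conjKoopman μ g₀ f₃‖ := by fun_prop
  simpa using h.tendsto g₀

end Recurrence

theorem mainTheorem3 {G : Type*} [Group G] [TopologicalSpace G] [IsTopologicalGroup G]
    [CompactSpace G] [T2Space G] [MeasurableSpace G] [BorelSpace G]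
    (μ : Measure G) [μ.IsHaarMeasure] [IsProbabilityMeasure μ]
    (D : ℝ) (hD : 1 ≤ D) (hG : IsQuasirandom G D)
    (f₁ f₂ f₃ : Lp ℂ 2 μ)
    (hf₁ : eLpNorm f₁ ∞ μ ≤ 1) (hf₂ : eLpNorm f₂ ∞ μ ≤ 1) (hf₃ : eLpNorm f₃ ∞ μ ≤ 1) :
    Integrable (recurrenceError μ f₁ f₂ f₃) μ ∧
      ∫ g, recurrenceError μ f₁ f₂ f₃ g ∂μ ≤ 4 * D ^ (-(1 / 4) : ℝ) := by
  have := regular_of_compactSpace μ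
  have h₁ : f₁ ∈ unitBoundedSet μ := ae_norm_le_one_of_eLpNorm_top_le hf₁
  have h₂ : f₂ ∈ unitBoundedSet μ := ae_norm_le_one_of_eLpNorm_top_le hf₂
  have h₃ : f₃ ∈ unitBoundedSet μ := ae_norm_le_one_of_eLpNorm_top_le hf₃
  have hcont := continuous_recurrenceError h₁ h₂ h₃
  refine ⟨hcont.integrable_of_compactSpace, le_of_forall_pos_le_add fun ε hε => ?_⟩
  obtain ⟨k₁, hk₁, hn₁⟩ := exists_continuous_norm_sub_toLp_le h₁ (by linarith : 0 < ε / 6)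
  obtain ⟨k₂, hk₂, hn₂⟩ := exists_continuous_norm_sub_toLp_le h₂ (by linarith : 0 < ε / 6)
  obtain ⟨k₃, hk₃, hn₃⟩ := exists_continuous_norm_sub_toLp_le h₃ (by linarith : 0 < ε / 6)
  have hm₁ := toLp_mem_unitBoundedSet (μ := μ) hk₁
  have hm₂ := toLp_mem_unitBoundedSet (μ := μ) hk₂
  have hm₃ := toLp_mem_unitBoundedSet (μ := μ) hk₃
  have hkcont := continuous_recurrenceError hm₁ hm₂ hm₃
  calc ∫ g, recurrenceError μ f₁ f₂ f₃ g ∂μ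
      ≤ ∫ g, (recurrenceError μ (ContinuousMap.toLp 2 μ ℂ k₁) (ContinuousMap.toLp 2 μ ℂ k₂)
          (ContinuousMap.toLp 2 μ ℂ k₃) g + ε) ∂μ := by
        refine integral_mono hcont.integrable_of_compactSpace
          (hkcont.integrable_of_compactSpace.add (integrable_const _)) fun g => ?_
        have := (abs_le.mp (abs_recurrenceError_sub_le h₁ h₂ h₃ hm₁ hm₂ hm₃ g)).2
        simp only
        linarith
    _ = ∫ g, recurrenceError μ (ContinuousMap.toLp 2 μ ℂ k₁) (ContinuousMap.toLp 2 μ ℂ k₂)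
          (ContinuousMap.toLp 2 μ ℂ k₃) g ∂μ + ε := by
        rw [integral_add hkcont.integrable_of_compactSpace (integrable_const _)]
        simp
    _ ≤ 4 * D ^ (-(1 / 4) : ℝ) + ε := by
        simp_rw [recurrenceError_toLp]
        gcongr
        exact hG.integral_triple_correlation_le hD k₁.continuous k₂.continuous k₃.continuous
          hk₁ hk₂ hk₃
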